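/- Let $H$ be a complex Hilbert space and let $L(H)$ be the space of bounded linear operators on $H$ with the operator norm. For $A \in L(H)$ write $N(A)$ and $R(A)$ for its kernel and range and $|A| = (A^*A)^{1/2}$. The operator $A$ is called semi-Fredholm if $R(A)$ is closed and at least one of $\dim N(A)$ and $\dim R(A)^\perp$ is finite. The angular factor of $A$ is the unique operator $Q_A \in L(H)$ such that $A = Q_A|A|$, $N(Q_A) = N(A)$, and $Q_A$ is a partial isometry, i.e. $\|Q_A x\| = \|x\|$ for all $x \in N(Q_A)^\perp$. Let $A \in L(H)$ be semi-Fredholm. Then there exists $\varepsilon > 0$ such that the mapping $$\{\lambda \in \mathbb{C} : 0 < |\lambda| < \varepsilon\} \to L(H), \qquad \lambda \mapsto Q_{A - \lambda I},$$ is continuous. -/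

import Mathlib

open scoped InnerProductSpace

section PolarDecomposition

variable {H : Type*} [NormedAddCommGroup H] [InnerProductSpace ℂ H] [CompleteSpace H]

/-- `A` is semi-Fredholm: its range is closed, and its nullity `dim N(A)` or its deficiency
`dim R(A)^⊥` is finite. -/
def IsSemiFredholm (A : H →L[ℂ] H) : Prop :=
  IsClosed (A.range : Set H) ∧
    (FiniteDimensional ℂ A.ker ∨ FiniteDimensional ℂ (A.range)ᗮ)

/-- `Q` is a partial isometry: it is isometric on the orthogonal complement of its kernel. -/
def IsPartialIsometry (Q : H →L[ℂ] H) : Prop :=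
  ∀ x ∈ (Q.ker)ᗮ, ‖Q x‖ = ‖x‖

/-- `Q` is the partial isometry of the polar decomposition `A = Q |A|`, normalized by
`N(Q) = N(A)`. Here `CFC.abs A = |A| = (A^* A)^{1/2}`. -/
structure IsAngularFactor (A Q : H →L[ℂ] H) : Prop where
  partialIsometry : IsPartialIsometry Q
  ker_eq : Q.ker = A.ker
  polar : A = Q * CFC.abs A

theorem norm_abs_apply (A : H →L[ℂ] H) (x : H) : ‖CFC.abs A x‖ = ‖A x‖ := by
  have hsa : star (CFC.abs A) = CFC.abs A := (CFC.abs_nonneg A).isSelfAdjoint.star_eq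
  have h : star (CFC.abs A) * CFC.abs A = star A * A := by rw [hsa, CFC.abs_mul_abs]
  have key : ∀ T : H →L[ℂ] H, ⟪(star T * T) x, x⟫_ℂ = (‖T x‖ : ℂ) ^ 2 := fun T => by
    rw [ContinuousLinearMap.star_eq_adjoint, mul_apply_eq_comp,
      ContinuousLinearMap.adjoint_inner_left, inner_self_eq_norm_sq_to_K]
    rfl
  have h2 : ((‖CFC.abs A x‖ : ℂ)) ^ 2 = (‖A x‖ : ℂ) ^ 2 := by rw [← key, ← key, h]
  exact (sq_eq_sq₀ (norm_nonneg _) (norm_nonneg _)).1 (by exact_mod_cast h2)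

theorem orthogonal_range_abs (A : H →L[ℂ] H) : ((CFC.abs A).range)ᗮ = A.ker := by
  have hsa : star (CFC.abs A) = CFC.abs A := (CFC.abs_nonneg A).isSelfAdjoint.star_eq
  rw [ContinuousLinearMap.orthogonal_range, ← ContinuousLinearMap.star_eq_adjoint, hsa]
  ext x
  have h := norm_abs_apply A x
  simp only [LinearMap.mem_ker, ContinuousLinearMap.coe_coe]
  rw [← norm_eq_zero, h, norm_eq_zero]

theorem IsAngularFactor.unique {A Q Q' : H →L[ℂ] H} (h : IsAngularFactor A Q)
    (h' : IsAngularFactor A Q') : Q = Q' := by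
  have hr : (CFC.abs A).range ≤ (Q - Q').ker := by
    rintro _ ⟨y, rfl⟩
    have h1 := congrArg (fun T : H →L[ℂ] H => T y) (h.polar.symm.trans h'.polar)
    simp only [mul_apply_eq_comp] at h1
    simp [h1]
  have hK : (CFC.abs A).range.topologicalClosure ≤ (Q - Q').ker :=
    Submodule.topologicalClosure_minimal _ hr (Q - Q').isClosed_ker
  have hN : ((CFC.abs A).range.topologicalClosure)ᗮ ≤ (Q - Q').ker := by
    rw [Submodule.orthogonal_closure, orthogonal_range_abs]
    intro x hx
    have h1 : x ∈ Q.ker := h.ker_eq ▸ hx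
    have h2 : x ∈ Q'.ker := h'.ker_eq ▸ hx
    have h1' : Q x = 0 := h1
    have h2' : Q' x = 0 := h2
    simp [h1', h2']
  have : CompleteSpace (CFC.abs A).range.topologicalClosure :=
    (Submodule.isClosed_topologicalClosure _).completeSpace_coe
  have htop : (⊤ : Submodule ℂ H) ≤ (Q - Q').ker := by
    rw [← Submodule.sup_orthogonal_of_hasOrthogonalProjection
      (K := (CFC.abs A).range.topologicalClosure)]
    exact sup_le hK hN
  ext x
  have hx : (Q - Q') x = 0 := htop (Submodule.mem_top (x := x))
  simpa [sub_eq_zero] using hx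

theorem exists_isAngularFactor (A : H →L[ℂ] H) : ∃ Q, IsAngularFactor A Q := by
  set K : Submodule ℂ H := (CFC.abs A).range.topologicalClosure with hKdef
  have : CompleteSpace K := (Submodule.isClosed_topologicalClosure _).completeSpace_coe
  have hmem : ∀ x, CFC.abs A x ∈ K := fun x =>
    Submodule.le_topologicalClosure _ (LinearMap.mem_range_self _ x)
  let e : H →ₗ[ℂ] K := LinearMap.codRestrict K (CFC.abs A).toLinearMap hmem
  have hdense : DenseRange e := by
    intro y
    rw [closure_subtype]
    have hy : (y : H) ∈ closure ((CFC.abs A).range : Set H) := y.2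
    refine closure_mono ?_ hy
    rintro _ ⟨x, rfl⟩
    exact ⟨e x, ⟨x, rfl⟩, rfl⟩
  have hnorm : ∀ x, ‖A x‖ = ‖e x‖ := fun x => (norm_abs_apply A x).symm
  let W : K →L[ℂ] H := (A : H →ₗ[ℂ] H).extendOfNorm e
  have hWe : ∀ x, W (e x) = A x := fun x =>
    LinearMap.extendOfNorm_eq hdense ⟨1, fun x => by rw [one_mul]; exact (hnorm x).le⟩ x
  have hWn : ∀ y, ‖W y‖ = ‖y‖ := fun y =>
    hdense.induction_on (p := fun y => ‖W y‖ = ‖y‖) y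
      (isClosed_eq (by fun_prop) (by fun_prop)) (fun x => by rw [hWe, hnorm])
  let Q : H →L[ℂ] H := W ∘L K.orthogonalProjectionOnto
  have hKo : Kᗮ = A.ker := by
    rw [hKdef, Submodule.orthogonal_closure, orthogonal_range_abs]
  have hQK : ∀ y : K, Q y = W y := fun y => by
    simp [Q]
  have hker : Q.ker = A.ker := by
    rw [← hKo]
    ext x
    have : Q x = 0 ↔ x ∈ Kᗮ := by
      rw [← norm_eq_zero]
      change ‖W (K.orthogonalProjectionOnto x)‖ = 0 ↔ _
      rw [hWn, norm_eq_zero, Submodule.orthogonalProjectionOnto_eq_zero_iff]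
    exact this
  refine ⟨Q, ?_, hker, ?_⟩
  · intro x hx
    rw [hker, ← hKo, Submodule.orthogonal_orthogonal] at hx
    have := hQK ⟨x, hx⟩
    simp only at this
    rw [this, hWn]
    rfl
  · ext x
    exact ((hQK (e x)).trans (hWe x)).symm

/-- The angular factor `Q_A` of `A`: the partial isometry in the polar decomposition of `A`. -/
noncomputable def angularFactor (A : H →L[ℂ] H) : H →L[ℂ] H :=
  (exists_isAngularFactor A).choose

theorem isAngularFactor_angularFactor (A : H →L[ℂ] H) : IsAngularFactor A (angularFactor A) :=
  (exists_isAngularFactor A).choose_spec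

theorem isAngularFactor_iff {A Q : H →L[ℂ] H} : IsAngularFactor A Q ↔ Q = angularFactor A :=
  ⟨fun h => h.unique (isAngularFactor_angularFactor A),
    fun h => h ▸ isAngularFactor_angularFactor A⟩

end PolarDecomposition

/-! Write `B z = A - z`. If `B` has closed range and `P` is the projection onto `N(B)`, then `|B| +
P` is invertible and `Q_B = B (|B| + P)⁻¹` (`angularFactor_eq_mul_inverse`). Since `B z` and `|B z|`
are norm continuous in `z`, only the kernel projection could jump.

Let `N(A)` be finite-dimensional. For `z ≠ 0`, `N(A - z)` lies in the hyperrange `M = ⋂ R(Aⁿ)`,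
which is closed and satisfies `A M = M`. So `T = A|M` is onto, `S = T - z` has `S S*` invertible for
small `z`, and the kernel projection is `1 - S* (S S*)⁻¹ S` on `M`, continuous in `z`
(`starProjection_ker_eq`). The point `0` is left out because `N(A)` need not lie in `M`.

Finite deficiency reduces to this case through `Q_{A*} = (Q_A)*`. -/

section PuncturedContinuity

variable {H : Type*} [NormedAddCommGroup H] [InnerProductSpace ℂ H]

/-! ### Kernel projections and the hyperrange -/

/-- The projection onto the kernel of an operator which on a closed invariant subspace
containing the kernel restricts to `T` with `T T^*` invertible. -/
theorem starProjection_ker_eq (B : H →L[ℂ] H) [B.ker.HasOrthogonalProjection]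
    (M : Submodule ℂ H) [CompleteSpace M] (hM : B.ker ≤ M) (T : M →L[ℂ] M)
    (hT : ∀ x, (T x : H) = B x) (hu : IsUnit (T * star T)) :
    B.ker.starProjection = M.subtypeL ∘L (1 - star T * Ring.inverse (T * star T) * T) ∘L
      M.orthogonalProjectionOnto := by
  ext x
  set y := M.orthogonalProjectionOnto x
  -- `T* w` is the part of `y` orthogonal to `N(T)`: it lies in `R(T*)` and has the same image as
  -- `y` under `T`.
  set w := (Ring.inverse (T * star T) * T) y
  refine Submodule.eq_starProjection_of_mem_of_inner_eq_zero (v := ((y - star T w : M) : H)) ?_ ?_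
  · have h1 : T (star T w) = T y := by
      change (T * star T * (Ring.inverse (T * star T) * T)) y = T y
      rw [← mul_assoc, Ring.mul_inverse_cancel _ hu, one_mul]
    change B ((y - star T w : M) : H) = 0
    rw [← hT, map_sub, h1, sub_self, Submodule.coe_zero]
  · intro k hk
    have hTk : T ⟨k, hM hk⟩ = 0 := Subtype.ext ((hT _).trans hk)
    have h1 : ⟪x - (y : H), k⟫_ℂ = 0 := Submodule.starProjection_inner_eq_zero x k (hM hk)
    have h2 : ⟪((star T w : M) : H), k⟫_ℂ = 0 := by
      change ⟪star T w, (⟨k, hM hk⟩ : M)⟫_ℂ = 0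
      rw [ContinuousLinearMap.star_eq_adjoint, ContinuousLinearMap.adjoint_inner_left, hTk,
        inner_zero_right]
    rw [Submodule.coe_sub, sub_sub_eq_add_sub, add_sub_right_comm, inner_add_left, h1, h2,
      add_zero]

/-- The hyperrange of an operator. -/
def hyperrange (A : H →L[ℂ] H) : Submodule ℂ H := ⨅ n : ℕ, (A ^ n).range

theorem mem_hyperrange {A : H →L[ℂ] H} {x : H} :
    x ∈ hyperrange A ↔ ∀ n : ℕ, ∃ y, (A ^ n) y = x := by
  rw [hyperrange, Submodule.mem_iInf]
  rfl

theorem antitone_range_pow (A : H →L[ℂ] H) : Antitone fun n : ℕ => (A ^ n).range := by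
  refine antitone_nat_of_succ_le fun n => ?_
  rintro _ ⟨x, rfl⟩
  exact ⟨A x, by rw [pow_succ]; rfl⟩

theorem apply_mem_hyperrange (A : H →L[ℂ] H) {x : H} (hx : x ∈ hyperrange A) :
    A x ∈ hyperrange A := by
  rw [mem_hyperrange] at hx ⊢
  intro n
  obtain ⟨y, rfl⟩ := hx n
  exact ⟨A y, by rw [← mul_apply_eq_comp, ← mul_apply_eq_comp, ← pow_succ, ← pow_succ']⟩

/-- With finite nullity, `A` maps its hyperrange onto itself. -/
theorem exists_mem_hyperrange_apply_eq (A : H →L[ℂ] H) [FiniteDimensional ℂ A.ker] {y : H}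
    (hy : y ∈ hyperrange A) : ∃ x ∈ hyperrange A, A x = y := by
  -- The spaces `N(A) ∩ R(Aⁿ)` decrease inside a finite-dimensional space, so they stabilize at some
  -- `n`. A preimage of `y` in `R(Aⁿ)` then lies in every `R(Aᵐ)`, since for `m ≥ n` it differs from
  -- a preimage in `R(Aᵐ)` by an element of `N(A) ∩ R(Aⁿ) = N(A) ∩ R(Aᵐ)`.
  let f : ℕ →o (Submodule ℂ A.ker)ᵒᵈ :=
    ⟨fun n => OrderDual.toDual ((A ^ n).range.comap A.ker.subtype), fun m n hmn =>
      Submodule.comap_mono (antitone_range_pow A hmn)⟩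
  obtain ⟨n, hn⟩ := IsArtinian.monotone_stabilizes f
  rw [mem_hyperrange] at hy
  have hstep : ∀ m, ∃ x ∈ (A ^ m).range, A x = y := fun m => by
    obtain ⟨w, hw⟩ := hy (m + 1)
    exact ⟨(A ^ m) w, ⟨w, rfl⟩, by rw [← hw, pow_succ']; rfl⟩
  obtain ⟨x, hx, hxy⟩ := hstep n
  refine ⟨x, ?_, hxy⟩
  rw [hyperrange, Submodule.mem_iInf]
  intro m
  rcases le_total m n with hmn | hmn
  · exact antitone_range_pow A hmn hx
  · obtain ⟨x', hx', hxy'⟩ := hstep m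
    have hk : x - x' ∈ A.ker := by
      change A (x - x') = 0
      rw [map_sub, hxy, hxy', sub_self]
    have h1 : (⟨x - x', hk⟩ : A.ker) ∈ (A ^ n).range.comap A.ker.subtype :=
      Submodule.sub_mem _ hx (antitone_range_pow A hmn hx')
    have h2 : (A ^ n).range.comap A.ker.subtype = (A ^ m).range.comap A.ker.subtype := hn m hmn
    rw [h2] at h1
    have h3 : x - x' ∈ (A ^ m).range := h1
    simpa using Submodule.add_mem _ h3 hx'

/-- Eigenvectors for nonzero eigenvalues lie in the hyperrange. -/
theorem ker_sub_smul_le_hyperrange (A : H →L[ℂ] H) {z : ℂ} (hz : z ≠ 0) :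
    (A - z • ContinuousLinearMap.id ℂ H).ker ≤ hyperrange A := by
  intro x hx
  have h0 : A x - z • x = 0 := hx
  have h1 : A x = z • x := sub_eq_zero.1 h0
  rw [mem_hyperrange]
  intro n
  have h2 : (A ^ n) x = z ^ n • x := by
    induction n with
    | zero => simp
    | succ n ih => rw [pow_succ, mul_apply_eq_comp, h1, map_smul, ih, smul_smul, pow_succ']
  exact ⟨(z ^ n)⁻¹ • x, by rw [map_smul, h2, smul_smul, inv_mul_cancel₀ (pow_ne_zero n hz),
    one_smul]⟩

variable [CompleteSpace H]

/-! ### Closed ranges and lower bounds -/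

/-- An operator that is bounded below on a closed subspace maps it onto a closed subspace. -/
theorem isClosed_map_of_bounded_below (A : H →L[ℂ] H) (V : Submodule ℂ H)
    (hV : IsClosed (V : Set H)) {c : ℝ} (hc : 0 < c) (h : ∀ x ∈ V, c * ‖x‖ ≤ ‖A x‖) :
    IsClosed (V.map A.toLinearMap : Set H) := by
  have : CompleteSpace V := hV.completeSpace_coe
  let f : V →L[ℂ] H := A ∘L V.subtypeL
  have hf : AntilipschitzWith ((⟨c, hc.le⟩ : NNReal)⁻¹) f := by
    refine f.antilipschitz_of_bound fun x => ?_
    change ‖x‖ ≤ c⁻¹ * ‖f x‖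
    rw [inv_mul_eq_div, le_div_iff₀ hc, mul_comm]
    exact h x x.2
  have h1 := hf.isClosed_range f.uniformContinuous
  convert h1 using 1
  ext y
  simp [f]

/-- An operator with closed range is bounded below on the orthogonal complement of its kernel. -/
theorem exists_bounded_below_of_isClosed_range (A : H →L[ℂ] H)
    (h : IsClosed (A.range : Set H)) :
    ∃ c : ℝ, 0 < c ∧ ∀ x ∈ (A.ker)ᗮ, c * ‖x‖ ≤ ‖A x‖ := by
  have : CompleteSpace A.ker := A.isClosed_ker.completeSpace_coe
  let f : (A.ker)ᗮ →L[ℂ] H := A ∘L (A.ker)ᗮ.subtypeL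
  have hinj : Function.Injective f := by
    rw [injective_iff_map_eq_zero]
    intro x hx
    have h1 : (x : H) ∈ A.ker := hx
    have h2 := Submodule.inner_right_of_mem_orthogonal h1 x.2
    simpa using h2
  have hr : Set.range f = (A.range : Set H) := by
    ext y
    constructor
    · rintro ⟨x, rfl⟩
      exact ⟨x, rfl⟩
    · rintro ⟨x, rfl⟩
      refine ⟨⟨x - A.ker.starProjection x, A.ker.sub_starProjection_mem_orthogonal x⟩, ?_⟩
      have : A (A.ker.starProjection x) = 0 := A.ker.starProjection_apply_mem x
      simp [f, this]
  obtain ⟨K, hK⟩ := f.antilipschitz_of_injective_of_isClosed_range hinj (hr ▸ h)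
  -- `K` may be zero, so `K + 1` is inverted instead.
  have hKp : (0 : ℝ) < K + 1 := by positivity
  refine ⟨(K + 1 : ℝ)⁻¹, by positivity, fun x hx => ?_⟩
  have h1 : ‖x‖ ≤ K * ‖A x‖ := f.bound_of_antilipschitz hK ⟨x, hx⟩
  rw [inv_mul_le_iff₀ hKp]
  nlinarith [norm_nonneg (A x)]

/-- If `A` is bounded below on the complement of its finite-dimensional kernel, it maps closed
subspaces to closed subspaces. -/
theorem isClosed_map_of_finiteDimensional_ker (A : H →L[ℂ] H) [FiniteDimensional ℂ A.ker]
    {c : ℝ} (hc : 0 < c) (h : ∀ x ∈ (A.ker)ᗮ, c * ‖x‖ ≤ ‖A x‖) (V : Submodule ℂ H)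
    (hV : IsClosed (V : Set H)) : IsClosed (V.map A.toLinearMap : Set H) := by
  -- `(V + N(A)) ∩ N(A)ᗮ` has the same image as `V`, and `A` is bounded below on it.
  have hW : IsClosed (((V ⊔ A.ker) ⊓ (A.ker)ᗮ : Submodule ℂ H) : Set H) :=
    (V.isClosed_sup_finiteDimensional _ hV).inter (Submodule.isClosed_orthogonal _)
  have := isClosed_map_of_bounded_below A _ hW hc fun x hx => h x hx.2
  convert this using 2
  refine le_antisymm ?_ ?_
  · rintro _ ⟨x, hx, rfl⟩
    have hP := A.ker.starProjection_apply_mem x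
    refine ⟨x - A.ker.starProjection x, ⟨Submodule.sub_mem _ (Submodule.mem_sup_left hx)
      (Submodule.mem_sup_right hP), A.ker.sub_starProjection_mem_orthogonal x⟩, ?_⟩
    have : A (A.ker.starProjection x) = 0 := hP
    simp [this]
  · rintro _ ⟨x, ⟨hx, -⟩, rfl⟩
    obtain ⟨v, hv, n, hn, rfl⟩ := Submodule.mem_sup.1 hx
    have : A n = 0 := hn
    exact ⟨v, hv, by simp [this]⟩

/-- Closedness of the range is stable under small perturbations, for finite nullity. -/
theorem isClosed_range_sub_smul (A : H →L[ℂ] H) [FiniteDimensional ℂ A.ker]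
    {c : ℝ} (h : ∀ x ∈ (A.ker)ᗮ, c * ‖x‖ ≤ ‖A x‖) {z : ℂ} (hz : ‖z‖ < c) :
    IsClosed ((A - z • ContinuousLinearMap.id ℂ H).range : Set H) := by
  set B := A - z • ContinuousLinearMap.id ℂ H
  -- On `N(A)ᗮ` the operator `B` is bounded below by `c - ‖z‖`; the remaining summand `B(N(A))` of
  -- the range is finite-dimensional.
  have h1 : IsClosed ((A.ker)ᗮ.map B.toLinearMap : Set H) := by
    refine isClosed_map_of_bounded_below B _ (Submodule.isClosed_orthogonal _)
      (sub_pos.2 hz) fun x hx => ?_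
    have h2 : ‖A x‖ - ‖z • x‖ ≤ ‖A x - z • x‖ := norm_sub_norm_le _ _
    rw [norm_smul] at h2
    have h3 := h x hx
    have h4 : B x = A x - z • x := rfl
    rw [h4]
    linarith
  have h2 := Submodule.isClosed_sup_finiteDimensional _ (A.ker.map B.toLinearMap) h1
  rwa [← Submodule.map_sup, sup_comm, Submodule.sup_orthogonal_of_hasOrthogonalProjection,
    Submodule.map_top] at h2

/-! ### A closed formula for the angular factor -/

/-- Adding the kernel projection to the modulus of an operator with closed range makes it
invertible. -/
theorem isUnit_abs_add_starProjection (B : H →L[ℂ] H) (h : IsClosed (B.range : Set H))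
    [B.ker.HasOrthogonalProjection] :
    IsUnit (CFC.abs B + B.ker.starProjection) := by
  obtain ⟨c, hc, hb⟩ := exists_bounded_below_of_isClosed_range B h
  set P := B.ker.starProjection
  have hBP : ∀ x, B (P x) = 0 := fun x => B.ker.starProjection_apply_mem x
  have hsa : star (CFC.abs B) = CFC.abs B := (CFC.abs_nonneg B).isSelfAdjoint.star_eq
  have hPsa : star P = P := (isSelfAdjoint_starProjection B.ker).star_eq
  have h1 : CFC.abs B * P = 0 := by
    ext x
    have := norm_abs_apply B (P x)
    rw [hBP, norm_zero, norm_eq_zero] at this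
    exact this
  have h2 : P * CFC.abs B = 0 := by
    have := congrArg star h1
    rwa [star_mul, hsa, hPsa, star_zero] at this
  have hPP : P * P = P := B.ker.isIdempotentElem_starProjection
  -- The cross terms vanish. The square is bounded below by `c ^ 2` on `N(B)ᗮ` and by `1` on `N(B)`,
  -- and invertibility of the square gives that of `|B| + P`.
  have hG : (CFC.abs B + P) * (CFC.abs B + P) = star B * B + P := by
    rw [add_mul, mul_add, mul_add, h1, h2, hPP, CFC.abs_mul_abs]
    simp
  have hu : IsUnit (star B * B + P) := by
    have hd : 0 < min (c ^ 2) 1 := by positivity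
    refine ContinuousLinearMap.isUnit_of_forall_le_norm_inner_map _
      (c := ⟨min (c ^ 2) 1, hd.le⟩) hd fun x => ?_
    have e1 : ⟪(star B * B) x, x⟫_ℂ = ((‖B x‖ ^ 2 : ℝ) : ℂ) := by
      rw [ContinuousLinearMap.star_eq_adjoint, mul_apply_eq_comp,
        ContinuousLinearMap.adjoint_inner_left, inner_self_eq_norm_sq_to_K]
      simp
    have e2 : ⟪P x, x⟫_ℂ = ((‖P x‖ ^ 2 : ℝ) : ℂ) := by
      have : P x = (star P * P) x := by rw [hPsa, hPP]
      conv_lhs => rw [this, ContinuousLinearMap.star_eq_adjoint, mul_apply_eq_comp,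
        ContinuousLinearMap.adjoint_inner_left, inner_self_eq_norm_sq_to_K]
      simp
    rw [add_apply, inner_add_left, e1, e2, ← Complex.ofReal_add,
      Complex.norm_real, Real.norm_of_nonneg (by positivity)]
    have h3 := hb (x - P x) (B.ker.sub_starProjection_mem_orthogonal x)
    rw [map_sub, hBP, sub_zero] at h3
    have h4 : ‖x‖ ^ 2 = ‖P x‖ ^ 2 + ‖x - P x‖ ^ 2 := by
      have : ⟪P x, x - P x⟫_ℂ = 0 := Submodule.inner_right_of_mem_orthogonal
        (B.ker.starProjection_apply_mem x) (B.ker.sub_starProjection_mem_orthogonal x)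
      have h5 := norm_add_sq_eq_norm_sq_add_norm_sq_of_inner_eq_zero (P x) (x - P x) this
      rw [add_sub_cancel] at h5
      simpa [sq] using h5
    change ‖x‖ ^ 2 * min (c ^ 2) 1 ≤ _
    have h6 : (c * ‖x - P x‖) ^ 2 ≤ ‖B x‖ ^ 2 := pow_le_pow_left₀ (by positivity) h3 2
    rw [h4]
    have h7 := min_le_left (c ^ 2) (1 : ℝ)
    have h8 := min_le_right (c ^ 2) (1 : ℝ)
    nlinarith [mul_le_mul_of_nonneg_left h7 (sq_nonneg ‖x - P x‖),
      mul_le_mul_of_nonneg_left h8 (sq_nonneg ‖P x‖)]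
  rw [← hG] at hu
  exact ((Commute.refl _).isUnit_mul_iff.1 hu).1

/-- The angular factor of an operator with closed range, as `B (|B| + P)⁻¹`. -/
theorem angularFactor_eq_mul_inverse (B : H →L[ℂ] H) (h : IsClosed (B.range : Set H))
    [B.ker.HasOrthogonalProjection] :
    angularFactor B = B * Ring.inverse (CFC.abs B + B.ker.starProjection) := by
  have hQ := isAngularFactor_angularFactor B
  have h1 : angularFactor B * B.ker.starProjection = 0 := by
    ext x
    have : B.ker.starProjection x ∈ (angularFactor B).ker := by
      rw [hQ.ker_eq]
      exact B.ker.starProjection_apply_mem x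
    exact this
  have h2 : angularFactor B * (CFC.abs B + B.ker.starProjection) = B := by
    rw [mul_add, h1, add_zero, ← hQ.polar]
  conv_rhs => lhs; rw [← h2]
  rw [mul_assoc, Ring.mul_inverse_cancel _ (isUnit_abs_add_starProjection B h), mul_one]

/-! ### Surjective operators and their perturbations -/

/-- If `T` is onto then `T T^*` is invertible. -/
theorem isUnit_mul_star_of_surjective (T : H →L[ℂ] H) (hT : Function.Surjective T) :
    IsUnit (T * star T) := by
  -- By the open mapping theorem `y = T x` with `‖x‖ ≤ C ‖y‖`; then `‖y‖² = ⟪T* y, x⟫ ≤ C ‖T* y‖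
  -- ‖y‖`, whence the bound `C⁻²`.
  obtain ⟨C, hC, h⟩ := T.exists_preimage_norm_le hT
  have hd : 0 < (C ^ 2)⁻¹ := by positivity
  refine ContinuousLinearMap.isUnit_of_forall_le_norm_inner_map _
    (c := ⟨(C ^ 2)⁻¹, hd.le⟩) hd fun y => ?_
  have e1 : ⟪(T * star T) y, y⟫_ℂ = ((‖star T y‖ ^ 2 : ℝ) : ℂ) := by
    rw [ContinuousLinearMap.star_eq_adjoint, mul_apply_eq_comp,
      ← ContinuousLinearMap.adjoint_inner_right, inner_self_eq_norm_sq_to_K]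
    simp
  rw [e1, Complex.norm_real, Real.norm_of_nonneg (by positivity)]
  change ‖y‖ ^ 2 * (C ^ 2)⁻¹ ≤ _
  rw [← div_eq_mul_inv, div_le_iff₀ (by positivity), ← mul_pow]
  refine pow_le_pow_left₀ (norm_nonneg _) ?_ 2
  obtain ⟨x, hx, hxn⟩ := h y
  have h2 : ‖y‖ ^ 2 ≤ ‖star T y‖ * ‖x‖ := by
    have e2 : ⟪star T y, x⟫_ℂ = ((‖y‖ ^ 2 : ℝ) : ℂ) := by
      rw [ContinuousLinearMap.star_eq_adjoint, ContinuousLinearMap.adjoint_inner_left, hx,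
        inner_self_eq_norm_sq_to_K]
      simp
    have := norm_inner_le_norm (𝕜 := ℂ) (star T y) x
    rwa [e2, Complex.norm_real, Real.norm_of_nonneg (by positivity)] at this
  rcases (norm_nonneg y).eq_or_lt with h0 | h0
  · rw [← h0]; positivity
  · nlinarith [norm_nonneg (star T y)]

/-- By induction each `R(Aⁿ⁺¹) = A(R(Aⁿ))` is closed; finite nullity is what lets `A` preserve
closedness of subspaces. -/
theorem isClosed_hyperrange (A : H →L[ℂ] H) [FiniteDimensional ℂ A.ker]
    {c : ℝ} (hc : 0 < c) (h : ∀ x ∈ (A.ker)ᗮ, c * ‖x‖ ≤ ‖A x‖) :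
    IsClosed (hyperrange A : Set H) := by
  have h1 : ∀ n : ℕ, IsClosed ((A ^ n).range : Set H) := by
    intro n
    induction n with
    | zero =>
      have : (A ^ 0).range = ⊤ := LinearMap.range_id
      rw [this]
      exact isClosed_univ
    | succ n ih =>
      have h2 := isClosed_map_of_finiteDimensional_ker A hc h _ ih
      convert h2 using 2
      rw [pow_succ', ← LinearMap.range_comp]
      rfl
  rw [hyperrange, Submodule.coe_iInf]
  exact isClosed_iInter h1

theorem continuousAt_ringInverse {E : Type*} [NormedRing E] [HasSummableGeomSeries E] {a : E}
    (ha : IsUnit a) : ContinuousAt Ring.inverse a := by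
  obtain ⟨u, rfl⟩ := ha
  exact NormedRing.inverse_continuousAt u

theorem continuous_mul_star_sub_smul (T : H →L[ℂ] H) :
    Continuous fun z : ℂ => (T - z • ContinuousLinearMap.id ℂ H) *
      star (T - z • ContinuousLinearMap.id ℂ H) := by
  fun_prop

theorem eventually_isUnit_mul_star (T : H →L[ℂ] H) (hT : Function.Surjective T) :
    ∀ᶠ z in nhds (0 : ℂ), IsUnit ((T - z • ContinuousLinearMap.id ℂ H) *
      star (T - z • ContinuousLinearMap.id ℂ H)) := by
  refine (continuous_mul_star_sub_smul T).continuousAt.eventually (Units.isOpen.mem_nhds ?_)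
  change IsUnit _
  simpa using isUnit_mul_star_of_surjective T hT

theorem continuousAt_one_sub_star_mul_inverse_mul (T : H →L[ℂ] H) {z : ℂ}
    (hu : IsUnit ((T - z • ContinuousLinearMap.id ℂ H) *
      star (T - z • ContinuousLinearMap.id ℂ H))) :
    ContinuousAt (fun z : ℂ => 1 - star (T - z • ContinuousLinearMap.id ℂ H) *
      Ring.inverse ((T - z • ContinuousLinearMap.id ℂ H) *
        star (T - z • ContinuousLinearMap.id ℂ H)) *
      (T - z • ContinuousLinearMap.id ℂ H)) z := by
  have hinv := ContinuousAt.comp (f := fun z : ℂ => (T - z • ContinuousLinearMap.id ℂ H) *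
    star (T - z • ContinuousLinearMap.id ℂ H)) (continuousAt_ringInverse hu)
    (continuous_mul_star_sub_smul T).continuousAt
  have hS : Continuous fun z : ℂ => T - z • ContinuousLinearMap.id ℂ H := by fun_prop
  exact continuousAt_const.sub ((hS.star.continuousAt.mul hinv).mul hS.continuousAt)

/-! ### Continuity for finite nullity -/

/-- The case of finite nullity. -/
theorem exists_continuousOn_angularFactor_of_finiteDimensional_ker (A : H →L[ℂ] H)
    [FiniteDimensional ℂ A.ker] {c : ℝ} (hc : 0 < c)
    (h : ∀ x ∈ (A.ker)ᗮ, c * ‖x‖ ≤ ‖A x‖) :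
    ∃ ε : ℝ, 0 < ε ∧
      ContinuousOn (fun z : ℂ => angularFactor (A - z • ContinuousLinearMap.id ℂ H))
        {z : ℂ | 0 < ‖z‖ ∧ ‖z‖ < ε} := by
  set M := hyperrange A
  have : CompleteSpace M := (isClosed_hyperrange A hc h).completeSpace_coe
  let T : M →L[ℂ] M := (A ∘L M.subtypeL).codRestrict M fun x => apply_mem_hyperrange A x.2
  have hTs : Function.Surjective T := fun y => by
    obtain ⟨x, hx, hxy⟩ := exists_mem_hyperrange_apply_eq A y.2
    exact ⟨⟨x, hx⟩, Subtype.ext hxy⟩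
  let S : ℂ → M →L[ℂ] M := fun z => T - z • ContinuousLinearMap.id ℂ M
  obtain ⟨δ, hδ, hδu⟩ := Metric.eventually_nhds_iff.1 (eventually_isUnit_mul_star T hTs)
  -- Below `c` the range of `A - z` stays closed; below `δ` the operator `S z * star (S z)` stays
  -- invertible.
  refine ⟨min c δ, lt_min hc hδ, ?_⟩
  let B : ℂ → H →L[ℂ] H := fun z => A - z • ContinuousLinearMap.id ℂ H
  have hB : Continuous B := by fun_prop
  have hK : ∀ z, CompleteSpace (B z).ker := fun z => (B z).isClosed_ker.completeSpace_coe
  let E : ℂ → H →L[ℂ] H := fun z =>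
    M.subtypeL ∘L (1 - star (S z) * Ring.inverse (S z * star (S z)) * S z) ∘L
      M.orthogonalProjectionOnto
  have hunit : ∀ z : ℂ, ‖z‖ < min c δ → IsUnit (S z * star (S z)) := fun z hz =>
    hδu (by simpa using hz.trans_le (min_le_right _ _))
  -- The puncture is needed here: `z ≠ 0` puts the kernel of `B z` inside `M`.
  have hE : ∀ z : ℂ, 0 < ‖z‖ → ‖z‖ < min c δ → (B z).ker.starProjection = E z := fun z hz hz' =>
    starProjection_ker_eq (B z) M (ker_sub_smul_le_hyperrange A (norm_pos_iff.1 hz)) (S z)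
      (fun x => rfl) (hunit z hz')
  have hcl : ∀ z : ℂ, ‖z‖ < min c δ → IsClosed ((B z).range : Set H) := fun z hz =>
    isClosed_range_sub_smul A h (hz.trans_le (min_le_left _ _))
  have heq : Set.EqOn (fun z => angularFactor (B z))
      (fun z => B z * Ring.inverse (CFC.abs (B z) + E z)) {z : ℂ | 0 < ‖z‖ ∧ ‖z‖ < min c δ} := by
    rintro z ⟨hz, hz'⟩
    simp only
    rw [angularFactor_eq_mul_inverse (B z) (hcl z hz'), hE z hz hz']
  refine ContinuousOn.congr ?_ heq
  rintro z ⟨hz, hz'⟩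
  refine ContinuousAt.continuousWithinAt ?_
  have hEc : ContinuousAt E z :=
    continuousAt_const.clm_comp ((continuousAt_one_sub_star_mul_inverse_mul T
      (hunit z hz')).clm_comp continuousAt_const)
  have habs : Continuous fun z => CFC.abs (B z) := CFC.continuous_abs.comp hB
  refine hB.continuousAt.mul (ContinuousAt.comp (f := fun z => CFC.abs (B z) + E z)
    (continuousAt_ringInverse ?_) (habs.continuousAt.add hEc))
  rw [← hE z hz hz']
  exact isUnit_abs_add_starProjection (B z) (hcl z hz')

/-! ### Passage to the adjoint -/

/-- A partial isometry satisfies `Q^* Q y = y` on the orthogonal complement of its kernel. -/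
theorem IsPartialIsometry.star_mul_apply {Q : H →L[ℂ] H} (hQ : IsPartialIsometry Q) {y : H}
    (hy : y ∈ (Q.ker)ᗮ) : star Q (Q y) = y := by
  have : CompleteSpace Q.ker := Q.isClosed_ker.completeSpace_coe
  -- As a linear isometry, `Q` restricted to `N(Q)ᗮ` preserves inner products and not only norms.
  let V : (Q.ker)ᗮ →ₗᵢ[ℂ] H := ⟨Q.toLinearMap ∘ₗ (Q.ker)ᗮ.subtype, fun x => hQ x x.2⟩
  refine ext_inner_right ℂ fun x => ?_
  have hP := Q.ker.starProjection_apply_mem x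
  have hx := Q.ker.sub_starProjection_mem_orthogonal x
  have h1 : Q x = Q (x - Q.ker.starProjection x) := by
    have : Q (Q.ker.starProjection x) = 0 := hP
    rw [map_sub, this, sub_zero]
  have h2 : ⟪Q y, Q (x - Q.ker.starProjection x)⟫_ℂ = ⟪y, x - Q.ker.starProjection x⟫_ℂ :=
    V.inner_map_map ⟨y, hy⟩ ⟨_, hx⟩
  rw [ContinuousLinearMap.star_eq_adjoint, ContinuousLinearMap.adjoint_inner_left, h1, h2,
    inner_sub_right, Submodule.inner_left_of_mem_orthogonal hP hy, sub_zero]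

/-- `N(Q*)ᗮ` is the closure of `R(Q)`. On `R(Q)` the norm identity follows from `Q* Q u = u` for `u
∈ N(Q)ᗮ`, and it extends to the closure by continuity. -/
theorem IsPartialIsometry.star {Q : H →L[ℂ] H} (hQ : IsPartialIsometry Q) :
    IsPartialIsometry (star Q) := by
  have : CompleteSpace Q.ker := Q.isClosed_ker.completeSpace_coe
  intro x hx
  have hx' : x ∈ closure (Q.range : Set H) := by
    rw [ContinuousLinearMap.star_eq_adjoint, ← ContinuousLinearMap.orthogonal_range,
      Submodule.orthogonal_orthogonal_eq_closure] at hx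
    exact hx
  refine closure_minimal (t := {x | ‖Star.star Q x‖ = ‖x‖}) ?_
    (isClosed_eq (by fun_prop) (by fun_prop)) hx'
  rintro _ ⟨y, rfl⟩
  have hP : Q (Q.ker.starProjection y) = 0 := Q.ker.starProjection_apply_mem y
  have hy := Q.ker.sub_starProjection_mem_orthogonal y
  have h1 : Q y = Q (y - Q.ker.starProjection y) := by rw [map_sub, hP, sub_zero]
  change ‖Star.star Q (Q y)‖ = ‖Q y‖
  rw [h1, hQ.star_mul_apply hy, hQ _ hy]

/-- The angular factor of the adjoint is the adjoint of the angular factor. -/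
theorem IsAngularFactor.star {A Q : H →L[ℂ] H} (h : IsAngularFactor A Q) :
    IsAngularFactor (star A) (star Q) := by
  have hsa : Star.star (CFC.abs A) = CFC.abs A := (CFC.abs_nonneg A).isSelfAdjoint.star_eq
  have hQ1 : Star.star Q * Q * CFC.abs A = CFC.abs A := by
    ext x
    refine h.partialIsometry.star_mul_apply ?_
    rw [h.ker_eq, ← orthogonal_range_abs]
    exact Submodule.le_orthogonal_orthogonal _ ⟨x, rfl⟩
  -- Uniqueness of positive square roots: since `Q* Q` fixes `R(|A|)`, the positive operator `Q |A|
  -- Q*` squares to `Q |A|² Q* = A A*`.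
  have habs : CFC.abs (Star.star A) = Q * CFC.abs A * Star.star Q := by
    refine CFC.sqrt_unique ?_ (star_right_conjugate_nonneg (CFC.abs_nonneg A) Q)
    calc Q * CFC.abs A * Star.star Q * (Q * CFC.abs A * Star.star Q)
        = Q * CFC.abs A * (Star.star Q * Q * CFC.abs A) * Star.star Q := by
          simp only [mul_assoc]
      _ = Q * CFC.abs A * Star.star (Q * CFC.abs A) := by
          rw [hQ1, star_mul, hsa]; simp only [mul_assoc]
      _ = Star.star (Star.star A) * Star.star A := by rw [← h.polar, star_star]
  refine ⟨h.partialIsometry.star, ?_, ?_⟩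
  · have hr : A = CFC.abs (Star.star A) * Q := by
      rw [habs]
      have h2 : CFC.abs A * (Star.star Q * Q) = CFC.abs A := by
        have := congrArg Star.star hQ1
        rwa [star_mul, star_mul, star_star, hsa] at this
      rw [mul_assoc, mul_assoc, h2, ← h.polar]
    have hA : Star.star A = Star.star Q * CFC.abs (Star.star A) := by
      conv_lhs => rw [hr]
      rw [star_mul, (CFC.abs_nonneg (Star.star A)).isSelfAdjoint.star_eq]
    have hA' : Star.star A = CFC.abs A * Star.star Q := by
      conv_lhs => rw [h.polar]
      rw [star_mul, hsa]
    refine le_antisymm (fun x hx => ?_) (fun x hx => ?_)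
    · have hx' : Star.star Q x = 0 := hx
      change Star.star A x = 0
      rw [hA', mul_apply_eq_comp, hx', map_zero]
    · have hx' : (CFC.abs A) (Star.star Q x) = 0 := by
        rw [← mul_apply_eq_comp, ← hA']; exact hx
      -- `N(|A|) = N(A) = N(Q)`, so `Q Q* x = 0` and hence `‖Q* x‖² = 0`.
      have h3 : Star.star Q x ∈ Q.ker := by
        rw [h.ker_eq]
        change A _ = 0
        rw [← norm_eq_zero, ← norm_abs_apply, hx', norm_zero]
      have h4 : Q (Star.star Q x) = 0 := h3
      change Star.star Q x = 0
      rw [← inner_self_eq_zero (𝕜 := ℂ)]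
      nth_rw 1 [ContinuousLinearMap.star_eq_adjoint]
      rw [ContinuousLinearMap.adjoint_inner_left, h4, inner_zero_right]
  · have hA' : Star.star A = CFC.abs A * Star.star Q := by
      conv_lhs => rw [h.polar]
      rw [star_mul, hsa]
    rw [habs, ← mul_assoc, ← mul_assoc, hQ1, ← hA']

theorem star_angularFactor (A : H →L[ℂ] H) :
    star (angularFactor A) = angularFactor (star A) :=
  isAngularFactor_iff.1 (isAngularFactor_angularFactor A).star

/-- If `A` has closed range, `A^*` is bounded below on the range of `A`. -/
theorem exists_bounded_below_star (A : H →L[ℂ] H) (h : IsClosed (A.range : Set H)) :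
    ∃ c : ℝ, 0 < c ∧ ∀ y ∈ ((star A).ker)ᗮ, c * ‖y‖ ≤ ‖star A y‖ := by
  obtain ⟨c, hc, hb⟩ := exists_bounded_below_of_isClosed_range A h
  have : CompleteSpace A.ker := A.isClosed_ker.completeSpace_coe
  have : CompleteSpace A.range := h.completeSpace_coe
  -- The constant of `A` also serves `A*`: for `y = A u` with `u ∈ N(A)ᗮ`, `‖A u‖² = ⟪A* A u, u⟫ ≤
  -- ‖A* A u‖ ‖u‖` and `c ‖u‖ ≤ ‖A u‖`.
  refine ⟨c, hc, fun y hy => ?_⟩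
  rw [ContinuousLinearMap.star_eq_adjoint, ← ContinuousLinearMap.orthogonal_range,
    Submodule.orthogonal_orthogonal] at hy
  obtain ⟨x, rfl⟩ := hy
  change c * ‖A x‖ ≤ ‖star A (A x)‖
  have hP : A (A.ker.starProjection x) = 0 := A.ker.starProjection_apply_mem x
  have hx := A.ker.sub_starProjection_mem_orthogonal x
  have h1 : A x = A (x - A.ker.starProjection x) := by rw [map_sub, hP, sub_zero]
  rw [h1]
  generalize x - A.ker.starProjection x = u at hx
  have h2 : ‖A u‖ ^ 2 ≤ ‖star A (A u)‖ * ‖u‖ := by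
    have e2 : ⟪star A (A u), u⟫_ℂ = ((‖A u‖ ^ 2 : ℝ) : ℂ) := by
      rw [ContinuousLinearMap.star_eq_adjoint, ContinuousLinearMap.adjoint_inner_left,
        inner_self_eq_norm_sq_to_K]
      simp
    have := norm_inner_le_norm (𝕜 := ℂ) (star A (A u)) u
    rwa [e2, Complex.norm_real, Real.norm_of_nonneg (by positivity)] at this
  have h3 := hb u hx
  rcases (norm_nonneg (A u)).eq_or_lt with h0 | h0
  · rw [← h0, mul_zero]; exact norm_nonneg _
  · nlinarith [norm_nonneg (star A (A u)), mul_le_mul_of_nonneg_left h3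
      (norm_nonneg (star A (A u)))]

end PuncturedContinuity

theorem mainTheorem5 {H : Type*} [NormedAddCommGroup H] [InnerProductSpace ℂ H] [CompleteSpace H]
    (A : H →L[ℂ] H) (hA : IsSemiFredholm A) :
    ∃ ε : ℝ, 0 < ε ∧
      ContinuousOn (fun z : ℂ => angularFactor (A - z • ContinuousLinearMap.id ℂ H))
        {z : ℂ | 0 < ‖z‖ ∧ ‖z‖ < ε} := by
  obtain ⟨hcl, hfin | hfin⟩ := hA
  · obtain ⟨c, hc, hb⟩ := exists_bounded_below_of_isClosed_range A hcl
    exact exists_continuousOn_angularFactor_of_finiteDimensional_ker A hc hb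
  · obtain ⟨c, hc, hb⟩ := exists_bounded_below_star A hcl
    have : FiniteDimensional ℂ (star A).ker := by
      rw [ContinuousLinearMap.star_eq_adjoint, ← ContinuousLinearMap.orthogonal_range]
      exact hfin
    obtain ⟨ε, hε, hcont⟩ :=
      exists_continuousOn_angularFactor_of_finiteDimensional_ker (star A) hc hb
    refine ⟨ε, hε, ?_⟩
    -- Since `(A - z)* = A* - z̄`, the map for `A` is the one for `A*` composed with conjugation,
    -- which preserves the punctured disc, and followed by the adjoint.
    have hcomp := (hcont.comp (s := {z : ℂ | 0 < ‖z‖ ∧ ‖z‖ < ε}) (f := fun z : ℂ => star z)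
      continuous_star.continuousOn (fun z hz => by simpa using hz)).star
    refine hcomp.congr fun z _ => ?_
    have hid : star (ContinuousLinearMap.id ℂ H) = ContinuousLinearMap.id ℂ H := star_one _
    simp only [Function.comp_apply]
    rw [star_angularFactor, star_sub, star_smul, star_star, star_star, hid]
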